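/- Let $j>0$, let $$K=\{u\in H^1(0,1):\ u(0)=0,\ u(1)=1,\ u\ge 0 \text{ on } (0,1)\}$$ (elements of $H^1(0,1)$ being identified with their continuous representatives on $[0,1]$), and let $$J(u)=\int_0^1\Big(\tfrac12 u'(y)^2+2j\sqrt{u(y)}\Big)\,dy .$$ A variational solution of the problem $-u''+\frac{j}{\sqrt u}=0$ on $(0,1)$, $u(0)=0$, $u(1)=1$, is a function $u\in K$ with $J(u)=\min_{v\in K}J(v)$. For $\xi\in[0,1)$, a free boundary solution with free boundary $\xi$ is a function $u\in K\cap C^1([0,1))$ such that $u=0$ on $[0,\xi]$, $u>0$ on $(\xi,1]$, $u'(\xi)=0$, $\frac1{\sqrt u}\in L^1(\xi,1)$ and $u''=\frac{j}{\sqrt u}$ a.e. on $(\xi,1)$ (with $u''$ the weak second derivative); if $\xi=0$ it is called a flat solution. Theorem. For every $j>0$ there exists a unique variational solution $u$. Moreover, with $j^*=\frac49$: a) if $j=j^*$, then $u$ is a flat solution and $u(y)=y^{4/3}$ for $y\in[0,1]$; b) if $j>j^*$, then $u$ is a free boundary solution with free boundary $\xi=1-\frac{1}{\sqrt{\frac94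 j}}$, and $u(y)=A\,(y-\xi)_+^{4/3}$ for $y\in[0,1]$, with $A=\big(\frac94 j\big)^{2/3}$; c) if $0<j<j^*$, then $u>0$ on $(0,1]$ and $u'(0)=K_0$ for some $K_0=K_0(j)>0$. -/

import Mathlib

open Set MeasureTheory
open scoped ContDiff

namespace ChildLangmuir

/-- `g` is a weak derivative of `f` on the open interval `(a, b)`: both functions are locally
integrable there and `∫ f φ' = - ∫ g φ` for every smooth `φ` compactly supported in `(a, b)`. -/
structure IsWeakDerivOn (a b : ℝ) (f g : ℝ → ℝ) : Prop where
  locallyIntegrableOn : LocallyIntegrableOn f (Ioo a b)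
  locallyIntegrableOn_deriv : LocallyIntegrableOn g (Ioo a b)
  integral_mul_deriv : ∀ φ : ℝ → ℝ, ContDiff ℝ ∞ φ → HasCompactSupport φ →
    tsupport φ ⊆ Ioo a b →
      ∫ y in Ioo a b, f y * deriv φ y = -∫ y in Ioo a b, g y * φ y

open Classical in
/-- The weak derivative of `f` on `(0, 1)`, which is unique up to null sets (and `0` if `f` has
none). -/
noncomputable def weakDeriv (f : ℝ → ℝ) : ℝ → ℝ :=
  if h : ∃ g, IsWeakDerivOn 0 1 f g then h.choose else 0

/-- The Sobolev space `H¹(0, 1)`: square integrable functions with a square integrable weak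
derivative. -/
def MemH1 (f : ℝ → ℝ) : Prop :=
  MemLp f 2 (volume.restrict (Ioo 0 1)) ∧
    ∃ g, IsWeakDerivOn 0 1 f g ∧ MemLp g 2 (volume.restrict (Ioo 0 1))

/-- The set `K` of all `u ∈ H¹(0, 1)` with `u 0 = 0`, `u 1 = 1` and `u ≥ 0` on `(0, 1)`. An element
of `H¹(0, 1)` is given by its continuous representative on `[0, 1]`, so that its boundary values
make sense; the values of `u` outside `[0, 1]` play no role. -/
def K : Set (ℝ → ℝ) :=
  {u | MemH1 u ∧ ContinuousOn u (Icc 0 1) ∧ u 0 = 0 ∧ u 1 = 1 ∧ ∀ y ∈ Ioo (0 : ℝ) 1, 0 ≤ u y}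

/-- The energy `J(u) = ∫₀¹ (u'² / 2 + 2 j √u)`. For `u ∈ K` the integrand is integrable. -/
noncomputable def energy (j : ℝ) (u : ℝ → ℝ) : ℝ :=
  ∫ y in Ioo (0 : ℝ) 1, ((weakDeriv u y) ^ 2 / 2 + 2 * j * √(u y))

/-- A variational solution of `-u'' + j / √u = 0`, `u 0 = 0`, `u 1 = 1`: a minimizer of the energy
over `K`. -/
def IsVariationalSolution (j : ℝ) (u : ℝ → ℝ) : Prop :=
  u ∈ K ∧ ∀ v ∈ K, energy j u ≤ energy j v

/-- The point `ξ ∈ [0, 1)` is the free boundary of `u`: `u = 0` on `[0, ξ]`, `u > 0` on `(ξ, 1]`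
and `u'(ξ) = 0` (a one-sided derivative if `ξ = 0`). -/
structure HasFreeBoundary (u : ℝ → ℝ) (ξ : ℝ) : Prop where
  mem_Ico : ξ ∈ Ico (0 : ℝ) 1
  eq_zero : ∀ y ∈ Icc 0 ξ, u y = 0
  pos : ∀ y ∈ Ioc ξ 1, 0 < u y
  hasDerivWithinAt : HasDerivWithinAt u 0 (Icc 0 1) ξ

/-- A solution of `-u'' + j / √u = 0`, `u 0 = 0`, `u 1 = 1` with free boundary `ξ`, the equation
being satisfied on `(ξ, 1)`, with `u''` the weak derivative of `u'`. -/
structure IsFreeBoundarySolution (j : ℝ) (u : ℝ → ℝ) (ξ : ℝ) : Prop where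
  mem_K : u ∈ K
  contDiffOn : ContDiffOn ℝ 1 u (Ico 0 1)
  hasFreeBoundary : HasFreeBoundary u ξ
  integrableOn : IntegrableOn (fun y => 1 / √(u y)) (Ioo ξ 1)
  equation : IsWeakDerivOn ξ 1 (deriv u) (fun y => j / √(u y))

/-- A flat solution: the case `ξ = 0`, that is, `u > 0` on `(0, 1]` and `u'(0) = 0`. -/
def IsFlatSolution (j : ℝ) (u : ℝ → ℝ) : Prop :=
  IsFreeBoundarySolution j u 0

/-- The critical value `j* = 4 / 9`. -/
noncomputable def jStar : ℝ := 4 / 9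

end ChildLangmuir

/-!
The energy is minimized by a calibration. Every solution of `-u'' + j / √u = 0` has the first
integral `u'² / 2 - 2 j √u = p² / 2`, so a nondecreasing solution with `u 0 = 0` and initial slope
`p ≥ 0` satisfies the first-order equation `u' = P u` with `P s = √(p² + 4 j √s)` (`speed`).
Completing the square, and using `∫₀¹ P(u) u' = ∫₀¹ P` for all `u ∈ K`, gives (`energy_eq`)

  `J(u) = (1 / 2) ∫₀¹ (u' - P(u))² + ∫₀¹ P - p² / 2`.

Hence, as soon as `u' = P u` has a solution in `K` for some `p`, this solution is a minimizer, and
every minimizer `v` satisfies `v' = P v` almost everywhere, that is `v y = ∫₀ʸ P(v)`, so that `v` is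
`C¹` on `[0, 1]`. As `P` is nondecreasing, the squared distance of two minimizers is nondecreasing;
it vanishes at `y = 1`, so the minimizer is unique (`eqOn_of_hasDerivWithinAt_of_monotone`).

For `j ≥ 4 / 9` the slope `p = 0` is right, with solution `A (y - ξ)₊ ^ (4 / 3)`
(`isSpeedSolution_freeSolution`); the condition on `j` says that `ξ ≥ 0`. For `j < 4 / 9` a solution
exists for some `p > 0`: in terms of the slope `q = u'` one has
`12 j² y = (q - p)² (q + 2 p)` and `√u = (q² - p²) / (4 j)`, and the condition `u 1 = 1` can be met
by the intermediate value theorem (`exists_initial_slope`, `exists_isSpeedSolution`). Then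
`u'(0) = P 0 = p`.

The chain rule and the fundamental theorem of calculus are needed for functions that only have a
weak derivative. The du Bois-Reymond lemma shows that a continuous function on `[0, 1]` with
integrable weak derivative is the integral of that derivative (`IsWeakDerivOn.eq_add_integral`),
hence absolutely continuous.
-/

namespace ChildLangmuir

/-! ### Weak derivatives on an interval -/

/-- A locally integrable function becomes integrable when multiplied by a test function. -/
theorem integrable_mul_of_tsupport_subset {s : Set ℝ} {k φ : ℝ → ℝ} (hk : LocallyIntegrableOn k s)
    (hφ : Continuous φ) (hφc : HasCompactSupport φ) (hφs : tsupport φ ⊆ s) :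
    Integrable (fun y => k y * φ y) := by
  have h1 : IntegrableOn (fun y => k y * φ y) (tsupport φ) :=
    (hk.integrableOn_compact_subset hφs hφc).mul_continuousOn hφ.continuousOn hφc
  exact (integrableOn_iff_integrable_of_support_subset
    ((Function.support_mul_subset_right k φ).trans (subset_tsupport φ))).1 h1

/-- A `C¹` function on `(a, b)` has its classical derivative as weak derivative. -/
theorem IsWeakDerivOn.of_hasDerivAt {a b : ℝ} {f g : ℝ → ℝ}
    (hf : ∀ y ∈ Ioo a b, HasDerivAt f (g y) y) (hg : ContinuousOn g (Ioo a b)) :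
    IsWeakDerivOn a b f g := by
  have hfc : ContinuousOn f (Ioo a b) := fun y hy => (hf y hy).continuousAt.continuousWithinAt
  refine ⟨hfc.locallyIntegrableOn measurableSet_Ioo, hg.locallyIntegrableOn measurableSet_Ioo, ?_⟩
  intro φ hφ hφc hφs
  have hφ' : Continuous (deriv φ) := hφ.continuous_deriv (by simp)
  have hd : tsupport (deriv φ) ⊆ tsupport φ :=
    closure_minimal support_deriv_subset isClosed_closure
  have hfl := hfc.locallyIntegrableOn (μ := volume) measurableSet_Ioo
  have i1 := integrable_mul_of_tsupport_subset hfl hφ'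
    (HasCompactSupport.of_support_subset_isCompact hφc support_deriv_subset) (hd.trans hφs)
  have i2 := integrable_mul_of_tsupport_subset
    (hg.locallyIntegrableOn (μ := volume) measurableSet_Ioo) hφ.continuous hφc hφs
  have i3 := integrable_mul_of_tsupport_subset hfl hφ.continuous hφc hφs
  have hder : ∀ y, HasDerivAt (fun y => f y * φ y) (g y * φ y + f y * deriv φ y) y := by
    intro y
    by_cases hy : y ∈ tsupport φ
    · exact (hf y (hφs hy)).mul ((hφ.differentiable (by simp)) y).hasDerivAt
    · have h0 : φ =ᶠ[nhds y] 0 := notMem_tsupport_iff_eventuallyEq.1 hy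
      have h1 : φ y = 0 := h0.eq_of_nhds
      have h2 : deriv φ y = 0 := by rw [h0.deriv_eq]; simp
      rw [h1, h2]
      simp only [mul_zero, add_zero]
      refine (hasDerivAt_const y (0 : ℝ)).congr_of_eventuallyEq ?_
      filter_upwards [h0] with z hz
      simp [hz]
  have h0 := integral_eq_zero_of_hasDerivAt_of_integrable hder (i2.add i1) i3
  rw [integral_add i2 i1] at h0
  rw [setIntegral_eq_integral_of_forall_compl_eq_zero,
    setIntegral_eq_integral_of_forall_compl_eq_zero]
  · linarith
  · intro y hy
    rw [image_eq_zero_of_notMem_tsupport (fun h => hy (hφs h)), mul_zero]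
  · intro y hy
    rw [image_eq_zero_of_notMem_tsupport (f := deriv φ) (fun h => hy (hφs (hd h))), mul_zero]

/-- Weak derivatives are unique up to null sets. -/
theorem IsWeakDerivOn.ae_eq {a b : ℝ} {f g g' : ℝ → ℝ} (h : IsWeakDerivOn a b f g)
    (h' : IsWeakDerivOn a b f g') : g =ᵐ[volume.restrict (Ioo a b)] g' := by
  have hloc := h.locallyIntegrableOn_deriv.sub h'.locallyIntegrableOn_deriv
  have key := isOpen_Ioo.ae_eq_zero_of_integral_contDiff_smul_eq_zero hloc ?_
  · filter_upwards [(ae_restrict_iff' measurableSet_Ioo).2 key] with y hy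
    simpa [sub_eq_zero] using hy
  · intro φ hφ hφc hφs
    have hint : ∀ k : ℝ → ℝ, LocallyIntegrableOn k (Ioo a b) →
        IntegrableOn (fun y => k y * φ y) (Ioo a b) := fun k hk =>
      (integrable_mul_of_tsupport_subset hk hφ.continuous hφc hφs).integrableOn
    have e := h.integral_mul_deriv φ hφ hφc hφs
    rw [h'.integral_mul_deriv φ hφ hφc hφs, neg_inj] at e
    rw [← setIntegral_eq_integral_of_forall_compl_eq_zero (s := Ioo a b)]
    · have : ∀ y, φ y • (g - g') y = g y * φ y - g' y * φ y := fun y => by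
        simp only [Pi.sub_apply, smul_eq_mul]; ring
      simp_rw [this]
      rw [integral_sub (hint g h.locallyIntegrableOn_deriv) (hint g' h'.locallyIntegrableOn_deriv)]
      linarith
    · intro y hy
      rw [image_eq_zero_of_notMem_tsupport (fun h => hy (hφs h)), zero_smul]

theorem IsWeakDerivOn.weakDeriv {f g : ℝ → ℝ} (h : IsWeakDerivOn 0 1 f g) :
    IsWeakDerivOn 0 1 f (weakDeriv f) := by
  have hex : ∃ g, IsWeakDerivOn 0 1 f g := ⟨g, h⟩
  rw [ChildLangmuir.weakDeriv, dif_pos hex]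
  exact hex.choose_spec

/-- The antiderivative of a test function of integral zero is a test function. -/
theorem exists_testFunction_deriv_eq {a b : ℝ} {ψ : ℝ → ℝ} (hψ : ContDiff ℝ ∞ ψ)
    (hψc : HasCompactSupport ψ) (hψs : tsupport ψ ⊆ Ioo a b) (h0 : ∫ y, ψ y = 0) :
    ∃ φ : ℝ → ℝ, ContDiff ℝ ∞ φ ∧ HasCompactSupport φ ∧ tsupport φ ⊆ Ioo a b ∧ deriv φ = ψ := by
  rcases (tsupport ψ).eq_empty_or_nonempty with he | hne
  · refine ⟨0, contDiff_const, HasCompactSupport.zero, by simp, ?_⟩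
    rw [tsupport_eq_empty_iff] at he
    rw [he]; exact deriv_zero
  obtain ⟨c, hc⟩ := IsCompact.exists_isLeast hψc hne
  obtain ⟨d, hd⟩ := IsCompact.exists_isGreatest hψc hne
  have hder : ∀ x, HasDerivAt (fun x => ∫ y in a..x, ψ y) (ψ x) x := fun x =>
    intervalIntegral.integral_hasDerivAt_right (hψ.continuous.intervalIntegrable _ _)
      (hψ.continuous.stronglyMeasurableAtFilter _ _) hψ.continuous.continuousAt
  have hderiv : deriv (fun x => ∫ y in a..x, ψ y) = ψ := funext fun x => (hder x).deriv
  have hz : ∀ y, y ∉ Icc c d → ψ y = 0 := fun y hy =>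
    image_eq_zero_of_notMem_tsupport fun h => hy ⟨hc.2 h, hd.2 h⟩
  have hac : a < c := (hψs hc.1).1
  have hsup : ∀ x, x ∉ Icc c d → ∫ y in a..x, ψ y = 0 := by
    intro x hx
    rcases lt_or_ge x c with hxc | hxc
    · refine intervalIntegral.integral_zero_ae (Filter.Eventually.of_forall fun y hy => hz y ?_)
      intro hy'
      have : y ≤ max a x := hy.2
      exact absurd hy'.1 (not_le.2 (this.trans_lt (max_lt hac hxc)))
    · have hxd : d < x := by
        by_contra hcon
        exact hx ⟨hxc, not_lt.1 hcon⟩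
      rw [intervalIntegral.integral_eq_integral_of_support_subset, h0]
      intro y hy
      have hy' : y ∈ Icc c d := by
        by_contra hcon
        exact hy (hz y hcon)
      exact ⟨hac.trans_le hy'.1, hy'.2.trans hxd.le⟩
  have hts : tsupport (fun x => ∫ y in a..x, ψ y) ⊆ Icc c d :=
    closure_minimal (fun x hx => by by_contra hcon; exact hx (hsup x hcon)) isClosed_Icc
  refine ⟨_, ?_, isCompact_Icc.of_isClosed_subset isClosed_closure hts,
    hts.trans (Icc_subset_Ioo hac (hψs hd.1).2), hderiv⟩
  rw [contDiff_infty_iff_deriv, hderiv]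
  exact ⟨fun x => (hder x).differentiableAt, hψ⟩

/-- **Du Bois-Reymond lemma**: a function whose weak derivative vanishes is constant. The constant
appears because every test function `ψ` becomes the derivative of another one when `∫ ψ` times a
fixed bump function of integral one is subtracted. -/
theorem ae_const_of_integral_mul_deriv_eq_zero {a b : ℝ} (hab : a < b) {f : ℝ → ℝ}
    (hf : LocallyIntegrableOn f (Ioo a b))
    (h : ∀ φ : ℝ → ℝ, ContDiff ℝ ∞ φ → HasCompactSupport φ → tsupport φ ⊆ Ioo a b →
      ∫ y in Ioo a b, f y * deriv φ y = 0) :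
    ∃ c, ∀ᵐ y ∂volume.restrict (Ioo a b), f y = c := by
  obtain ⟨η, hη, hηc, hηs, hη1⟩ : ∃ η : ℝ → ℝ, ContDiff ℝ ∞ η ∧ HasCompactSupport η ∧
      tsupport η ⊆ Ioo a b ∧ ∫ y, η y = 1 := by
    let B : ContDiffBump ((a + b) / 2) :=
      ⟨(b - a) / 8, (b - a) / 4, by linarith, by linarith⟩
    refine ⟨B.normed volume, B.contDiff_normed, B.hasCompactSupport_normed, ?_, B.integral_normed⟩
    rw [B.tsupport_normed_eq, Real.closedBall_eq_Icc]
    exact Icc_subset_Ioo (by simp only [B]; linarith) (by simp only [B]; linarith)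
  have hint : ∀ φ : ℝ → ℝ, Continuous φ → HasCompactSupport φ → tsupport φ ⊆ Ioo a b →
      IntegrableOn (fun y => f y * φ y) (Ioo a b) := fun φ hφ hφc hφs =>
    (integrable_mul_of_tsupport_subset hf hφ hφc hφs).integrableOn
  refine ⟨∫ y in Ioo a b, f y * η y, ?_⟩
  set c := ∫ y in Ioo a b, f y * η y with hc
  have key := isOpen_Ioo.ae_eq_zero_of_integral_contDiff_smul_eq_zero
    (hf.sub (locallyIntegrableOn_const c)) ?_
  · filter_upwards [(ae_restrict_iff' measurableSet_Ioo).2 key] with y hy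
    simpa [sub_eq_zero] using hy
  · intro ψ hψ hψc hψs
    have iψ := hψ.continuous.integrable_of_hasCompactSupport (μ := volume) hψc
    have iη := hη.continuous.integrable_of_hasCompactSupport (μ := volume) hηc
    set m := ∫ y, ψ y with hm
    have hts : tsupport (fun y => ψ y - m * η y) ⊆ tsupport ψ ∪ tsupport η :=
      closure_minimal (fun y hy => by
        by_contra hcon
        rw [mem_union, not_or] at hcon
        apply hy
        simp [image_eq_zero_of_notMem_tsupport hcon.1, image_eq_zero_of_notMem_tsupport hcon.2])
        (isClosed_closure.union isClosed_closure)
    obtain ⟨φ, hφ, hφc, hφs, hφd⟩ := exists_testFunction_deriv_eq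
      (ψ := fun y => ψ y - m * η y) (hψ.sub (contDiff_const.mul hη))
      ((IsCompact.union hψc hηc).of_isClosed_subset isClosed_closure hts)
      (hts.trans (union_subset hψs hηs))
      (by rw [integral_sub iψ (iη.const_mul m), integral_const_mul, hη1]; simp [hm])
    have e := h φ hφ hφc hφs
    rw [hφd] at e
    have e2 : ∀ y, f y * (ψ y - m * η y) = f y * ψ y - m * (f y * η y) := fun y => by ring
    simp_rw [e2] at e
    rw [integral_sub (hint ψ hψ.continuous hψc hψs)
      ((hint η hη.continuous hηc hηs).const_mul m), integral_const_mul] at e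
    have hz : ∀ y, y ∉ Ioo a b → ψ y = 0 := fun y hy =>
      image_eq_zero_of_notMem_tsupport fun h => hy (hψs h)
    rw [← setIntegral_eq_integral_of_forall_compl_eq_zero (s := Ioo a b)]
    · have : ∀ y, ψ y • (f - (fun _ => c : ℝ → ℝ)) y = f y * ψ y - c * ψ y := fun y => by
        simp only [Pi.sub_apply, smul_eq_mul]; ring
      simp_rw [this]
      rw [integral_sub (hint ψ hψ.continuous hψc hψs) (iψ.integrableOn.const_mul c),
        integral_const_mul, setIntegral_eq_integral_of_forall_compl_eq_zero hz, ← hm]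
      linarith
    · intro y hy
      rw [hz y hy, zero_smul]

/-- A continuous function on `[a, b]` with integrable weak derivative is the integral of the
latter. -/
theorem IsWeakDerivOn.eq_add_integral {a b : ℝ} (hab : a < b) {f g : ℝ → ℝ}
    (h : IsWeakDerivOn a b f g) (hf : ContinuousOn f (Icc a b))
    (hg : IntervalIntegrable g volume a b)
    {y : ℝ} (hy : y ∈ Icc a b) : f y = f a + ∫ t in a..y, g t := by
  have hG := hg.absolutelyContinuousOnInterval_intervalIntegral (c := a) (by simp)
  have hGc := hG.continuousOn
  rw [uIcc_of_le hab.le] at hGc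
  obtain ⟨c, hc⟩ := ae_const_of_integral_mul_deriv_eq_zero hab
    (f := fun x => f x - ∫ t in a..x, g t)
    (((hf.sub hGc).mono Ioo_subset_Icc_self).locallyIntegrableOn measurableSet_Ioo) (by
      intro φ hφ hφc hφs
      have hφA : AbsolutelyContinuousOnInterval φ a b :=
        ((hφ.of_le (by simp)).contDiffOn).absolutelyContinuousOnInterval
      have hφ' : Continuous (deriv φ) := hφ.continuous_deriv (by simp)
      have hz : ∀ y, y ∉ Ioo a b → φ y = 0 := fun y hy =>
        image_eq_zero_of_notMem_tsupport fun h => hy (hφs h)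
      have e := hG.integral_mul_deriv_eq_deriv_mul hφA
      rw [hz a (by simp), hz b (by simp)] at e
      have e1 : ∫ x in a..b, deriv (fun x => ∫ v in a..x, g v) x * φ x =
          ∫ x in a..b, g x * φ x := by
        refine intervalIntegral.integral_congr_ae ?_
        filter_upwards [hg.ae_hasDerivAt_integral] with x hx hx'
        rw [(hx (uIoc_subset_uIcc hx') a (by simp)).deriv]
      rw [e1] at e
      have e2 := h.integral_mul_deriv φ hφ hφc hφs
      rw [← integral_Ioc_eq_integral_Ioo, ← integral_Ioc_eq_integral_Ioo,
        ← intervalIntegral.integral_of_le hab.le, ← intervalIntegral.integral_of_le hab.le] at e2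
      rw [← integral_Ioc_eq_integral_Ioo, ← intervalIntegral.integral_of_le hab.le]
      simp_rw [sub_mul]
      rw [← uIcc_of_le hab.le] at hf hGc
      have i1 : IntervalIntegrable (fun x => f x * deriv φ x) volume a b :=
        (hf.mul hφ'.continuousOn).intervalIntegrable
      have i2 : IntervalIntegrable (fun x => (∫ t in a..x, g t) * deriv φ x) volume a b :=
        (hGc.mul hφ'.continuousOn).intervalIntegrable
      rw [intervalIntegral.integral_sub i1 i2]
      linarith)
  have hcc := Measure.eqOn_Icc_of_ae_eq volume hab.ne
    (f := fun x => f x - ∫ t in a..x, g t) (g := fun _ => c)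
    (by rw [← restrict_Ioo_eq_restrict_Icc]; exact hc) (hf.sub hGc) continuousOn_const
  have h1 := hcc (left_mem_Icc.2 hab.le)
  have h2 := hcc hy
  simp only [intervalIntegral.integral_same, sub_zero] at h1 h2
  linarith

theorem MemH1.isWeakDerivOn {u : ℝ → ℝ} (hu : MemH1 u) : IsWeakDerivOn 0 1 u (weakDeriv u) := by
  obtain ⟨-, g, hg, -⟩ := hu
  exact hg.weakDeriv

theorem MemH1.memLp_weakDeriv {u : ℝ → ℝ} (hu : MemH1 u) :
    MemLp (weakDeriv u) 2 (volume.restrict (Ioo 0 1)) := by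
  obtain ⟨-, g, hg, hg2⟩ := hu
  exact hg2.ae_eq (hg.ae_eq hg.weakDeriv)

theorem MemH1.intervalIntegrable_weakDeriv {u : ℝ → ℝ} (hu : MemH1 u) :
    IntervalIntegrable (weakDeriv u) volume 0 1 := by
  rw [intervalIntegrable_iff_integrableOn_Ioo_of_le zero_le_one]
  exact hu.memLp_weakDeriv.integrable (by norm_num)

theorem eq_integral_weakDeriv_of_mem_K {u : ℝ → ℝ} (hu : u ∈ K) {y : ℝ} (hy : y ∈ Icc (0 : ℝ) 1) :
    u y = ∫ t in (0 : ℝ)..y, weakDeriv u t := by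
  have := hu.1.isWeakDerivOn.eq_add_integral zero_lt_one hu.2.1 hu.1.intervalIntegrable_weakDeriv hy
  rwa [hu.2.2.1, zero_add] at this

/-! ### The calibration identity -/

/-- The slope `√(p² + 4 j √s)` that the first integral `u'² / 2 - 2 j √u = p² / 2` of the equation
prescribes at height `s`, for a nondecreasing solution with initial slope `p`. -/
noncomputable def speed (p j s : ℝ) : ℝ :=
  √(p ^ 2 + 4 * j * √s)

theorem continuous_speed (p j : ℝ) : Continuous (speed p j) := by
  unfold speed; fun_prop

theorem monotone_speed (p : ℝ) {j : ℝ} (hj : 0 ≤ j) : Monotone (speed p j) := fun s t hst => by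
  unfold speed
  gcongr

theorem speed_sq (p : ℝ) {j : ℝ} (hj : 0 ≤ j) (s : ℝ) : speed p j s ^ 2 = p ^ 2 + 4 * j * √s :=
  Real.sq_sqrt (by positivity)

theorem speed_zero {p : ℝ} (hp : 0 ≤ p) (j : ℝ) : speed p j 0 = p := by
  simp [speed, Real.sqrt_sq hp]

theorem _root_.LipschitzOnWith.comp_absolutelyContinuousOnInterval {X Y : Type*}
    [PseudoMetricSpace X] [PseudoMetricSpace Y] {g : X → Y} {f : ℝ → X} {s : Set X} {C : NNReal}
    {a b : ℝ} (hg : LipschitzOnWith C g s) (hf : AbsolutelyContinuousOnInterval f a b)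
    (hs : MapsTo f (uIcc a b) s) : AbsolutelyContinuousOnInterval (g ∘ f) a b := by
  rw [absolutelyContinuousOnInterval_iff] at hf ⊢
  intro ε hε
  obtain ⟨δ, hδ, h⟩ := hf (ε / (C + 1)) (by positivity)
  refine ⟨δ, hδ, fun E hE hlt => ?_⟩
  calc ∑ i ∈ Finset.range E.1, dist ((g ∘ f) (E.2 i).1) ((g ∘ f) (E.2 i).2)
      ≤ ∑ i ∈ Finset.range E.1, C * dist (f (E.2 i).1) (f (E.2 i).2) := by
        refine Finset.sum_le_sum fun i hi => ?_
        exact hg.dist_le_mul _ (hs (hE.1 i hi).1) _ (hs (hE.1 i hi).2)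
    _ = C * ∑ i ∈ Finset.range E.1, dist (f (E.2 i).1) (f (E.2 i).2) := (Finset.mul_sum _ _ _).symm
    _ ≤ C * (ε / (C + 1)) := by gcongr; exact (h E hE hlt).le
    _ < (C + 1) * (ε / (C + 1)) := by gcongr; linarith
    _ = ε := by field

/-- Change of variables `s = ∫ₐʸ w` in the integral of a continuous function, for `w` merely
integrable. -/
theorem integral_comp_mul_eq_integral {a b : ℝ} {P w : ℝ → ℝ} (hP : Continuous P)
    (hw : IntervalIntegrable w volume a b) :
    ∫ y in a..b, P (∫ t in a..y, w t) * w y = ∫ s in (0 : ℝ)..(∫ t in a..b, w t), P s := by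
  have hU := hw.absolutelyContinuousOnInterval_intervalIntegral (c := a) (by simp)
  obtain ⟨C, hC⟩ := hU.exists_bound
  have hG : ∀ x, HasDerivAt (fun x => ∫ s in (0 : ℝ)..x, P s) (P x) x := fun x =>
    intervalIntegral.integral_hasDerivAt_right (hP.intervalIntegrable _ _)
      (hP.stronglyMeasurableAtFilter _ _) hP.continuousAt
  have hG1 : ContDiff ℝ 1 (fun x => ∫ s in (0 : ℝ)..x, P s) := by
    rw [contDiff_one_iff_deriv]
    refine ⟨fun x => (hG x).differentiableAt, ?_⟩
    rwa [funext fun x => (hG x).deriv]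
  obtain ⟨L, hL⟩ := hG1.contDiffOn.exists_lipschitzOnWith (s := Icc (-C) C) (by decide)
    (convex_Icc _ _) isCompact_Icc
  have hGU := hL.comp_absolutelyContinuousOnInterval hU
    (fun y hy => abs_le.1 (by simpa using hC y hy))
  have e := hGU.integral_deriv_eq_sub
  simp only [Function.comp_apply, intervalIntegral.integral_same, sub_zero] at e
  rw [← e]
  refine intervalIntegral.integral_congr_ae ?_
  filter_upwards [hw.ae_hasDerivAt_integral] with x hx hx'
  exact ((hG _).comp x (hx (uIoc_subset_uIcc hx') a (by simp))).deriv.symm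

theorem memLp_of_continuousOn_Icc {a b : ℝ} {f : ℝ → ℝ} (hf : ContinuousOn f (Icc a b))
    (q : ENNReal) : MemLp f q (volume.restrict (Ioo a b)) := by
  obtain ⟨C, hC⟩ := isCompact_Icc.exists_bound_of_continuousOn hf
  refine MemLp.of_bound ((hf.mono Ioo_subset_Icc_self).aestronglyMeasurable measurableSet_Ioo) C ?_
  filter_upwards [ae_restrict_mem measurableSet_Ioo] with y hy
  exact hC y (Ioo_subset_Icc_self hy)

theorem memLp_weakDeriv_sub_speed {p j : ℝ} {u : ℝ → ℝ} (hu : u ∈ K) :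
    MemLp (fun y => weakDeriv u y - speed p j (u y)) 2 (volume.restrict (Ioo 0 1)) :=
  hu.1.memLp_weakDeriv.sub
    (memLp_of_continuousOn_Icc ((continuous_speed p j).comp_continuousOn hu.2.1) 2)

/-- The calibration identity: up to a constant that does not depend on `u ∈ K`, the energy is
half the squared `L²` distance of `u'` to the slope `speed p j u`. -/
theorem energy_eq (p : ℝ) {j : ℝ} (hj : 0 ≤ j) {u : ℝ → ℝ} (hu : u ∈ K) :
    energy j u = (∫ y in Ioo (0 : ℝ) 1, (weakDeriv u y - speed p j (u y)) ^ 2) / 2 +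
      ((∫ s in (0 : ℝ)..1, speed p j s) - p ^ 2 / 2) := by
  have hw := hu.1.intervalIntegrable_weakDeriv
  have hPu : ContinuousOn (fun y => speed p j (u y)) (Icc 0 1) :=
    (continuous_speed p j).comp_continuousOn hu.2.1
  have i1 := (memLp_weakDeriv_sub_speed (p := p) (j := j) hu).integrable_sq
  have i2 : IntegrableOn (fun y => speed p j (u y) * weakDeriv u y) (Ioo 0 1) := by
    rw [← intervalIntegrable_iff_integrableOn_Ioo_of_le zero_le_one]
    exact hw.continuousOn_mul (by rwa [uIcc_of_le zero_le_one])
  have e : ∫ y in Ioo (0 : ℝ) 1, speed p j (u y) * weakDeriv u y =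
      ∫ s in (0 : ℝ)..1, speed p j s := by
    have h1 : ∫ t in (0 : ℝ)..1, weakDeriv u t = 1 := by
      rw [← eq_integral_weakDeriv_of_mem_K hu (by simp), hu.2.2.2.1]
    have h2 := integral_comp_mul_eq_integral (continuous_speed p j) hw
    rw [h1] at h2
    rw [← h2, intervalIntegral.integral_of_le zero_le_one, integral_Ioc_eq_integral_Ioo]
    refine setIntegral_congr_fun measurableSet_Ioo fun y hy => ?_
    rw [← eq_integral_weakDeriv_of_mem_K hu (Ioo_subset_Icc_self hy)]
  have e2 : ∀ y, weakDeriv u y ^ 2 / 2 + 2 * j * √(u y) =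
      (weakDeriv u y - speed p j (u y)) ^ 2 / 2 +
        (speed p j (u y) * weakDeriv u y - p ^ 2 / 2) := fun y => by
    linear_combination (-1 / 2 : ℝ) * speed_sq p hj (u y)
  have ic : Integrable (fun _ : ℝ => p ^ 2 / 2) (volume.restrict (Ioo (0 : ℝ) 1)) :=
    integrable_const _
  have i3 : Integrable (fun y => speed p j (u y) * weakDeriv u y - p ^ 2 / 2)
      (volume.restrict (Ioo (0 : ℝ) 1)) := i2.sub ic
  unfold energy
  simp_rw [e2]
  rw [integral_add (i1.div_const 2) i3, integral_sub i2 ic, e, integral_div]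
  simp

/-! ### Solutions of the first-order equation -/

/-- `u` solves the first-order problem `u' = speed p j u` on `(0, 1)`, `u 0 = 0`, `u 1 = 1`. -/
structure IsSpeedSolution (p j : ℝ) (u : ℝ → ℝ) : Prop where
  continuousOn : ContinuousOn u (Icc 0 1)
  apply_zero : u 0 = 0
  apply_one : u 1 = 1
  nonneg : ∀ y ∈ Ioo (0 : ℝ) 1, 0 ≤ u y
  hasDerivAt : ∀ y ∈ Ioo (0 : ℝ) 1, HasDerivAt u (speed p j (u y)) y

theorem IsSpeedSolution.continuousOn_speed {p j : ℝ} {u : ℝ → ℝ} (hu : IsSpeedSolution p j u) :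
    ContinuousOn (fun y => speed p j (u y)) (Icc 0 1) :=
  (continuous_speed p j).comp_continuousOn hu.continuousOn

theorem IsSpeedSolution.isWeakDerivOn {p j : ℝ} {u : ℝ → ℝ} (hu : IsSpeedSolution p j u) :
    IsWeakDerivOn 0 1 u (fun y => speed p j (u y)) :=
  .of_hasDerivAt hu.hasDerivAt (hu.continuousOn_speed.mono Ioo_subset_Icc_self)

theorem IsSpeedSolution.mem_K {p j : ℝ} {u : ℝ → ℝ} (hu : IsSpeedSolution p j u) : u ∈ K :=
  ⟨⟨memLp_of_continuousOn_Icc hu.continuousOn 2, _, hu.isWeakDerivOn,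
    memLp_of_continuousOn_Icc hu.continuousOn_speed 2⟩,
    hu.continuousOn, hu.apply_zero, hu.apply_one, hu.nonneg⟩

theorem IsSpeedSolution.energy_eq {p j : ℝ} (hj : 0 ≤ j) {u : ℝ → ℝ} (hu : IsSpeedSolution p j u) :
    energy j u = (∫ s in (0 : ℝ)..1, speed p j s) - p ^ 2 / 2 := by
  rw [ChildLangmuir.energy_eq p hj hu.mem_K, integral_eq_zero_of_ae, zero_div, zero_add]
  filter_upwards [hu.isWeakDerivOn.weakDeriv.ae_eq hu.isWeakDerivOn] with y hy
  simp [hy]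

theorem IsSpeedSolution.isVariationalSolution {p j : ℝ} (hj : 0 ≤ j) {u : ℝ → ℝ}
    (hu : IsSpeedSolution p j u) : IsVariationalSolution j u := by
  refine ⟨hu.mem_K, fun v hv => ?_⟩
  rw [hu.energy_eq hj, ChildLangmuir.energy_eq p hj hv]
  have : 0 ≤ ∫ y in Ioo (0 : ℝ) 1, (weakDeriv v y - speed p j (v y)) ^ 2 :=
    integral_nonneg fun y => sq_nonneg _
  linarith

/-- If the first-order problem has a solution, then the square in the calibration identity vanishes
for every minimizer `v`, that is, `v' = speed p j v` almost everywhere. -/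
theorem IsSpeedSolution.eq_integral_of_isVariationalSolution {p j : ℝ} (hj : 0 ≤ j) {u v : ℝ → ℝ}
    (hu : IsSpeedSolution p j u) (hv : IsVariationalSolution j v) {y : ℝ}
    (hy : y ∈ Icc (0 : ℝ) 1) : v y = ∫ t in (0 : ℝ)..y, speed p j (v t) := by
  have hle := hv.2 u hu.mem_K
  rw [hu.energy_eq hj, ChildLangmuir.energy_eq p hj hv.1] at hle
  have hint := (memLp_weakDeriv_sub_speed (p := p) (j := j) hv.1).integrable_sq
  have h0 : ∫ y in Ioo (0 : ℝ) 1, (weakDeriv v y - speed p j (v y)) ^ 2 = 0 :=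
    le_antisymm (by linarith) (integral_nonneg fun y => sq_nonneg _)
  rw [integral_eq_zero_iff_of_nonneg (fun y => sq_nonneg _) hint] at h0
  rw [eq_integral_weakDeriv_of_mem_K hv.1 hy]
  refine intervalIntegral.integral_congr_ae_restrict ?_
  rw [uIoc_of_le hy.1, ← restrict_Ioo_eq_restrict_Ioc]
  refine ae_restrict_of_ae_restrict_of_subset (Ioo_subset_Ioo_right hy.2) ?_
  filter_upwards [h0] with t ht
  simpa [sub_eq_zero] using ht

theorem IsSpeedSolution.hasDerivWithinAt_of_isVariationalSolution {p j : ℝ} (hj : 0 ≤ j)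
    {u v : ℝ → ℝ} (hu : IsSpeedSolution p j u) (hv : IsVariationalSolution j v) {y : ℝ}
    (hy : y ∈ Icc (0 : ℝ) 1) : HasDerivWithinAt v (speed p j (v y)) (Icc 0 1) y := by
  have hc : ContinuousOn (fun y => speed p j (v y)) (Icc 0 1) :=
    (continuous_speed p j).comp_continuousOn hv.1.2.1
  have : Fact (y ∈ Icc (0 : ℝ) 1) := ⟨hy⟩
  have key : HasDerivWithinAt (fun x => ∫ t in (0 : ℝ)..x, speed p j (v t)) (speed p j (v y))
      (Icc 0 1) y := by
    refine intervalIntegral.integral_hasDerivWithinAt_right ?_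
      (hc.stronglyMeasurableAtFilter_nhdsWithin measurableSet_Icc y) (hc y hy)
    refine (hc.mono ?_).intervalIntegrable
    rw [uIcc_of_le hy.1]
    exact Icc_subset_Icc_right hy.2
  exact key.congr_of_mem (fun x hx => hu.eq_integral_of_isVariationalSolution hj hv hx) hy

/-- Uniqueness for the first-order equation comes from running it backwards from the
right endpoint: as the slope increases with the height, the distance of two solutions is
nondecreasing. Forward uniqueness can fail, as the slope need not be Lipschitz. -/
theorem eqOn_of_hasDerivWithinAt_of_monotone {P u v : ℝ → ℝ} (hP : Monotone P)
    {a b : ℝ} (hu : ∀ y ∈ Icc a b, HasDerivWithinAt u (P (u y)) (Icc a b) y)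
    (hv : ∀ y ∈ Icc a b, HasDerivWithinAt v (P (v y)) (Icc a b) y) (hb : u b = v b) :
    EqOn u v (Icc a b) := by
  have hd : ∀ y ∈ Icc a b, HasDerivWithinAt (fun y => (u y - v y) ^ 2)
      (2 * ((u y - v y) * (P (u y) - P (v y)))) (Icc a b) y := fun y hy =>
    (((hu y hy).sub (hv y hy)).pow 2).congr_deriv (by simp; ring)
  have hm : MonotoneOn (fun y => (u y - v y) ^ 2) (Icc a b) := by
    refine monotoneOn_of_hasDerivWithinAt_nonneg (convex_Icc a b)
      (fun y hy => (hd y hy).continuousWithinAt)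
      (fun y hy => (hd y (interior_subset hy)).mono interior_subset) fun y _ => ?_
    rcases le_total (u y) (v y) with h | h
    · have := hP h
      nlinarith
    · have := hP h
      nlinarith
  intro y hy
  have h := hm hy (right_mem_Icc.2 (hy.1.trans hy.2)) hy.2
  simp only [hb, sub_self] at h
  have h2 : (u y - v y) ^ 2 = 0 := le_antisymm (by simpa using h) (sq_nonneg _)
  exact sub_eq_zero.1 (pow_eq_zero_iff two_ne_zero |>.1 h2)

theorem IsSpeedSolution.eqOn_of_isVariationalSolution {p j : ℝ} (hj : 0 ≤ j)
    {u v : ℝ → ℝ} (hu : IsSpeedSolution p j u) (hv : IsVariationalSolution j v) :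
    EqOn v u (Icc 0 1) :=
  eqOn_of_hasDerivWithinAt_of_monotone (monotone_speed p hj)
    (fun _ hy => hu.hasDerivWithinAt_of_isVariationalSolution hj hv hy)
    (fun _ hy => hu.hasDerivWithinAt_of_isVariationalSolution hj (hu.isVariationalSolution hj) hy)
    (hv.1.2.2.2.1.trans hu.apply_one.symm)

/-! ### The solution with a free boundary -/

theorem hasDerivAt_max_zero_rpow {r : ℝ} (hr : 1 < r) (x : ℝ) :
    HasDerivAt (fun x => max x 0 ^ r) (r * max x 0 ^ (r - 1)) x := by
  have hc : ∀ q : ℝ, 0 ≤ q → Continuous fun x : ℝ => max x 0 ^ q := fun q hq =>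
    (continuous_id.max continuous_const).rpow_const fun _ => Or.inr hq
  have hne : ∀ x : ℝ, x ≠ 0 → HasDerivAt (fun x => max x 0 ^ r) (r * max x 0 ^ (r - 1)) x := by
    intro x hx
    rcases lt_or_gt_of_ne hx with hx | hx
    · rw [max_eq_right hx.le, Real.zero_rpow (by linarith), mul_zero]
      refine (hasDerivAt_const x (0 : ℝ)).congr_of_eventuallyEq ?_
      filter_upwards [gt_mem_nhds hx] with z hz
      rw [max_eq_right (le_of_lt hz), Real.zero_rpow (by linarith)]
    · rw [max_eq_left hx.le]
      refine (Real.hasDerivAt_rpow_const (Or.inl hx.ne')).congr_of_eventuallyEq ?_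
      filter_upwards [lt_mem_nhds hx] with z hz
      rw [max_eq_left (le_of_lt hz)]
  rcases eq_or_ne x 0 with rfl | hx
  · exact hasDerivAt_of_hasDerivAt_of_ne hne (hc r (by linarith)).continuousAt
      (continuous_const.mul (hc (r - 1) (by linarith))).continuousAt
  · exact hne x hx

/-- The point where the solution starting with slope zero leaves zero. -/
noncomputable def freeBoundary (j : ℝ) : ℝ :=
  1 - 1 / √(9 / 4 * j)

/-- The function `A (y - ξ)₊ ^ (4 / 3)` with `ξ = freeBoundary j` and `A = (9 j / 4) ^ (2 / 3)`. -/
noncomputable def freeSolution (j y : ℝ) : ℝ :=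
  (9 / 4 * j) ^ (2 / 3 : ℝ) * max (y - freeBoundary j) 0 ^ (4 / 3 : ℝ)

theorem freeBoundary_lt_one {j : ℝ} (hj : 0 < j) : freeBoundary j < 1 := by
  unfold freeBoundary
  have : 0 < √(9 / 4 * j) := Real.sqrt_pos.2 (by linarith)
  have : 0 < 1 / √(9 / 4 * j) := by positivity
  linarith

theorem freeBoundary_nonneg {j : ℝ} (hj : 4 / 9 ≤ j) : 0 ≤ freeBoundary j := by
  have h : 1 ≤ √(9 / 4 * j) := Real.one_le_sqrt.2 (by linarith)
  have := (div_le_one (zero_lt_one.trans_le h)).2 h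
  unfold freeBoundary
  linarith

theorem freeSolution_pos {j y : ℝ} (hj : 0 < j) (hy : freeBoundary j < y) :
    0 < freeSolution j y := by
  unfold freeSolution
  have : 0 < max (y - freeBoundary j) 0 := lt_max_of_lt_left (sub_pos.2 hy)
  positivity

theorem freeSolution_eq_zero {j y : ℝ} (hy : y ≤ freeBoundary j) : freeSolution j y = 0 := by
  rw [freeSolution, max_eq_right (sub_nonpos.2 hy), Real.zero_rpow (by norm_num), mul_zero]

theorem freeSolution_one {j : ℝ} (hj : 0 < j) : freeSolution j 1 = 1 := by
  have h0 : 0 < 9 / 4 * j := by linarith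
  have h1 : 1 - freeBoundary j = (9 / 4 * j) ^ (-(1 / 2) : ℝ) := by
    rw [freeBoundary, Real.rpow_neg h0.le, ← Real.sqrt_eq_rpow]; ring
  rw [freeSolution, h1, max_eq_left (by positivity), ← Real.rpow_mul h0.le, ← Real.rpow_add h0]
  norm_num

theorem speed_freeSolution {j : ℝ} (hj : 0 < j) (y : ℝ) :
    speed 0 j (freeSolution j y) =
      (9 / 4 * j) ^ (2 / 3 : ℝ) * (4 / 3 * max (y - freeBoundary j) 0 ^ (4 / 3 - 1 : ℝ)) := by
  have h0 : 0 < 9 / 4 * j := by linarith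
  unfold freeSolution
  -- In terms of the cube roots `a` of `9 j / 4` and `n` of `(y - ξ)₊` the claim is polynomial.
  have hm0 : 0 ≤ max (y - freeBoundary j) 0 := le_max_right _ _
  generalize max (y - freeBoundary j) 0 = m at hm0 ⊢
  obtain ⟨a, ha, ha2, ha3⟩ : ∃ a : ℝ, 0 ≤ a ∧ (9 / 4 * j) ^ (2 / 3 : ℝ) = a ^ 2 ∧
      a ^ 3 = 9 / 4 * j := by
    refine ⟨(9 / 4 * j) ^ (1 / 3 : ℝ), by positivity, ?_, ?_⟩ <;>
      rw [← Real.rpow_natCast, ← Real.rpow_mul h0.le] <;> norm_num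
  obtain ⟨n, hn, hn4, hn1⟩ : ∃ n : ℝ, 0 ≤ n ∧ m ^ (4 / 3 : ℝ) = n ^ 4 ∧
      m ^ (4 / 3 - 1 : ℝ) = n := by
    refine ⟨m ^ (4 / 3 - 1 : ℝ), by positivity, ?_, rfl⟩
    rw [← Real.rpow_natCast, ← Real.rpow_mul hm0]; norm_num
  rw [ha2, hn4, hn1, speed, show a ^ 2 * n ^ 4 = (a * n ^ 2) ^ 2 by ring,
    Real.sqrt_sq (by positivity),
    show 0 ^ 2 + 4 * j * (a * n ^ 2) = (a ^ 2 * (4 / 3 * n)) ^ 2 by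
      linear_combination (-16 / 9 * a * n ^ 2) * ha3, Real.sqrt_sq (by positivity)]

theorem isSpeedSolution_freeSolution {j : ℝ} (hj : 4 / 9 ≤ j) :
    IsSpeedSolution 0 j (freeSolution j) := by
  have hj0 : 0 < j := by linarith
  have hd : ∀ y, HasDerivAt (freeSolution j) (speed 0 j (freeSolution j y)) y := fun y => by
    rw [speed_freeSolution hj0]
    exact ((hasDerivAt_max_zero_rpow (by norm_num) (y - freeBoundary j)).comp_sub_const
      y (freeBoundary j)).const_mul _
  exact
    { continuousOn := fun y _ => (hd y).continuousAt.continuousWithinAt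
      apply_zero := freeSolution_eq_zero (freeBoundary_nonneg hj)
      apply_one := freeSolution_one hj0
      nonneg := fun y _ => by unfold freeSolution; positivity
      hasDerivAt := fun y _ => hd y }

theorem integrableOn_one_div_sqrt_freeSolution {j : ℝ} (hj : 0 < j) :
    IntegrableOn (fun y => 1 / √(freeSolution j y)) (Ioo (freeBoundary j) 1) := by
  have h0 : 0 < 9 / 4 * j := by linarith
  have hi : IntervalIntegrable (fun x : ℝ => x ^ (-(2 / 3) : ℝ)) volume 0 (1 - freeBoundary j) :=
    intervalIntegral.intervalIntegrable_rpow' (by norm_num)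
  have h2 := (hi.comp_sub_right (freeBoundary j)).const_mul ((9 / 4 * j) ^ (-(1 / 3) : ℝ))
  rw [zero_add, sub_add_cancel,
    intervalIntegrable_iff_integrableOn_Ioo_of_le (freeBoundary_lt_one hj).le] at h2
  refine h2.congr_fun (fun y hy => ?_) measurableSet_Ioo
  have hy' : 0 < y - freeBoundary j := sub_pos.2 hy.1
  simp only [freeSolution]
  rw [max_eq_left hy'.le, Real.sqrt_mul (by positivity), Real.sqrt_eq_rpow, Real.sqrt_eq_rpow,
    ← Real.rpow_mul h0.le, ← Real.rpow_mul hy'.le, Real.rpow_neg h0.le, Real.rpow_neg hy'.le]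
  norm_num [mul_comm]

/-! ### The solution with positive initial slope -/

/-- A continuous strictly increasing function on `[a, b]` has a continuous right inverse. -/
theorem exists_continuous_rightInverse {a b : ℝ} (hab : a ≤ b) {f : ℝ → ℝ}
    (hf : ContinuousOn f (Icc a b)) (hm : StrictMonoOn f (Icc a b)) :
    ∃ r : ℝ → ℝ, Continuous r ∧ (∀ y, r y ∈ Icc a b) ∧ ∀ y ∈ Icc (f a) (f b), f (r y) = y := by
  have hfab : f a ≤ f b := hm.monotoneOn (left_mem_Icc.2 hab) (right_mem_Icc.2 hab) hab
  have hmaps : MapsTo f (Icc a b) (Icc (f a) (f b)) := fun x hx =>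
    ⟨hm.monotoneOn (left_mem_Icc.2 hab) hx hx.1, hm.monotoneOn hx (right_mem_Icc.2 hab) hx.2⟩
  have hsm : StrictMono (hmaps.restrict f (Icc a b) (Icc (f a) (f b))) := fun x y hxy =>
    hm x.2 y.2 hxy
  have hsurj : Function.Surjective (hmaps.restrict f (Icc a b) (Icc (f a) (f b))) := by
    rintro ⟨y, hy⟩
    obtain ⟨x, hx, hxy⟩ := intermediate_value_Icc hab hf hy
    exact ⟨⟨x, hx⟩, Subtype.ext hxy⟩
  let e := hsm.orderIsoOfSurjective _ hsurj
  refine ⟨fun y => (e.symm (projIcc (f a) (f b) hfab y) : ℝ),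
    continuous_subtype_val.comp (e.symm.continuous.comp continuous_projIcc), fun y => (e.symm _).2,
    fun y hy => ?_⟩
  have h := e.apply_symm_apply (projIcc (f a) (f b) hfab y)
  rw [projIcc_of_mem hfab hy] at h
  simp only [projIcc_of_mem hfab hy]
  exact congrArg Subtype.val h

/-- Below the critical value some initial slope `p > 0` makes the solution reach height `1` exactly
at `y = 1`: there its slope is `√(p² + 4 j)`. -/
theorem exists_initial_slope {j : ℝ} (hj : 0 < j) (hj' : j < 4 / 9) :
    ∃ p, 0 < p ∧ (√(p ^ 2 + 4 * j) - p) ^ 2 * (√(p ^ 2 + 4 * j) + 2 * p) = 12 * j ^ 2 := by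
  let F : ℝ → ℝ := fun p => (√(p ^ 2 + 4 * j) - p) ^ 2 * (√(p ^ 2 + 4 * j) + 2 * p)
  have hF : Continuous F := by fun_prop
  have h0 : 12 * j ^ 2 < F 0 := by
    have h1 : 3 * j < √(4 * j) := Real.lt_sqrt_of_sq_lt (by nlinarith)
    have h2 : √(4 * j) ^ 2 = 4 * j := Real.sq_sqrt (by linarith)
    have h3 : F 0 = √(4 * j) ^ 2 * √(4 * j) := by simp only [F]; ring_nf
    rw [h3, h2]
    nlinarith
  have h3 : F 3 ≤ 12 * j ^ 2 := by
    simp only [F]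
    have h1 : √(3 ^ 2 + 4 * j) ^ 2 = 3 ^ 2 + 4 * j := Real.sq_sqrt (by linarith)
    have h2 : 0 ≤ √(3 ^ 2 + 4 * j) := Real.sqrt_nonneg _
    generalize √(3 ^ 2 + 4 * j) = q at h1 h2 ⊢
    have hjq : j = (q ^ 2 - 9) / 4 := by linarith
    have : 0 ≤ (q - 3) ^ 2 * (3 / 4 * (q + 3) ^ 2 - (q + 6)) :=
      mul_nonneg (sq_nonneg _) (by nlinarith)
    rw [hjq]
    nlinarith
  obtain ⟨p, hp, hpF⟩ := intermediate_value_Icc' (by norm_num : (0 : ℝ) ≤ 3) hF.continuousOn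
    ⟨h3, h0.le⟩
  refine ⟨p, lt_of_le_of_ne hp.1 ?_, hpF⟩
  rintro rfl
  exact h0.ne' hpF

/-- The slope `q = u'` of a solution `u` satisfies `q' = j / √u = 4 j² / (q² - p²)`, so that `y` is
a cubic polynomial in `q`. Inverting this polynomial gives `q`, hence `u`. -/
theorem exists_isSpeedSolution {p j : ℝ} (hj : 0 < j) (hp : 0 < p)
    (h : (√(p ^ 2 + 4 * j) - p) ^ 2 * (√(p ^ 2 + 4 * j) + 2 * p) = 12 * j ^ 2) :
    ∃ u, IsSpeedSolution p j u := by
  have hb2 : √(p ^ 2 + 4 * j) ^ 2 = p ^ 2 + 4 * j := Real.sq_sqrt (by positivity)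
  have hpb : p < √(p ^ 2 + 4 * j) := Real.lt_sqrt_of_sq_lt (by linarith)
  generalize √(p ^ 2 + 4 * j) = b at h hb2 hpb
  let Q : ℝ → ℝ := fun q => (q - p) ^ 2 * (q + 2 * p) / (12 * j ^ 2)
  have hQ : ∀ q, HasDerivAt Q ((q ^ 2 - p ^ 2) / (4 * j ^ 2)) q := fun q => by
    have := ((((hasDerivAt_id q).sub_const p).pow 2).mul
      ((hasDerivAt_id q).add_const (2 * p))).div_const (12 * j ^ 2)
    refine this.congr_deriv ?_
    simp
    field_simp
    ring
  have hQp : Q p = 0 := by simp [Q]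
  have hQb : Q b = 1 := by
    simp only [Q, h]
    exact div_self (by positivity)
  have hQc : ContinuousOn Q (Icc p b) := fun q _ => (hQ q).continuousAt.continuousWithinAt
  have hpos : ∀ q, p < q → 0 < (q ^ 2 - p ^ 2) / (4 * j ^ 2) := fun q hq =>
    div_pos (by nlinarith) (by positivity)
  have hQm : StrictMonoOn Q (Icc p b) := by
    refine strictMonoOn_of_deriv_pos (convex_Icc p b) hQc fun q hq => ?_
    rw [interior_Icc] at hq
    rw [(hQ q).deriv]
    exact hpos q hq.1
  obtain ⟨r, hrc, hr, hQr⟩ := exists_continuous_rightInverse hpb.le hQc hQm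
  rw [hQp, hQb] at hQr
  have hr0 : r 0 = p := hQm.injOn (hr 0) (left_mem_Icc.2 hpb.le)
    ((hQr 0 (by simp)).trans hQp.symm)
  have hr1 : r 1 = b := hQm.injOn (hr 1) (right_mem_Icc.2 hpb.le)
    ((hQr 1 (by simp)).trans hQb.symm)
  have hsp : ∀ y, speed p j (((r y ^ 2 - p ^ 2) / (4 * j)) ^ 2) = r y := fun y => by
    have h1 := (hr y).1
    have h2 : 0 ≤ (r y ^ 2 - p ^ 2) / (4 * j) := div_nonneg (by nlinarith) (by positivity)
    rw [speed, Real.sqrt_sq h2, mul_div_cancel₀ _ (by positivity), add_sub_cancel,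
      Real.sqrt_sq (by linarith)]
  refine ⟨fun y => ((r y ^ 2 - p ^ 2) / (4 * j)) ^ 2, by fun_prop, ?_, ?_, fun y _ => sq_nonneg _,
    fun y hy => ?_⟩
  · simp [hr0]
  · simp only [hr1, hb2]
    field_simp
    ring
  · rw [hsp]
    have hry : p < r y := by
      refine lt_of_le_of_ne (hr y).1 fun heq => ?_
      have := hQr y (Ioo_subset_Icc_self hy)
      rw [← heq, hQp] at this
      exact hy.1.ne this
    have hd := HasDerivAt.of_local_left_inverse hrc.continuousAt (hQ (r y)) (hpos _ hry).ne' (by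
      filter_upwards [Icc_mem_nhds hy.1 hy.2] with z hz using hQr z hz)
    refine ((((hd.pow 2).sub_const (p ^ 2)).div_const (4 * j)).pow 2).congr_deriv ?_
    have : r y ^ 2 - p ^ 2 ≠ 0 := by nlinarith
    simp
    field_simp
    ring

/-! ### Regularity and the second-order equation -/

theorem contDiffOn_of_hasDerivWithinAt_speed {p j : ℝ} {v : ℝ → ℝ}
    (hv : ∀ y ∈ Icc (0 : ℝ) 1, HasDerivWithinAt v (speed p j (v y)) (Icc 0 1) y) :
    ContDiffOn ℝ 1 v (Icc 0 1) := by
  have hud := uniqueDiffOn_Icc (zero_lt_one (α := ℝ))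
  have hc : ContinuousOn v (Icc 0 1) := fun y hy => (hv y hy).continuousWithinAt
  rw [contDiffOn_one_iff_derivWithin hud]
  refine ⟨fun y hy => (hv y hy).differentiableWithinAt, ?_⟩
  exact ((continuous_speed p j).comp_continuousOn hc).congr fun y hy =>
    (hv y hy).derivWithin (hud y hy)

/-- Differentiating `u' = speed p j u` gives `u'' = j / √u` wherever `u` is positive. -/
theorem hasDerivAt_deriv_of_hasDerivWithinAt_speed {p j : ℝ} (hj : 0 < j) {v : ℝ → ℝ}
    (hv : ∀ y ∈ Icc (0 : ℝ) 1, HasDerivWithinAt v (speed p j (v y)) (Icc 0 1) y)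
    {y : ℝ} (hy : y ∈ Ioo (0 : ℝ) 1) (hpos : 0 < v y) : HasDerivAt (deriv v) (j / √(v y)) y := by
  have hd : ∀ z ∈ Ioo (0 : ℝ) 1, HasDerivAt v (speed p j (v z)) z := fun z hz =>
    (hv z (Ioo_subset_Icc_self hz)).hasDerivAt (Icc_mem_nhds hz.1 hz.2)
  have hs : 0 < √(v y) := Real.sqrt_pos.2 hpos
  have hin : 0 < p ^ 2 + 4 * j * √(v y) := by positivity
  have h1 := ((((hd y hy).sqrt hpos.ne').const_mul (4 * j)).const_add (p ^ 2)).sqrt hin.ne'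
  have h2 : HasDerivAt (fun z => speed p j (v z)) (j / √(v y)) y := by
    refine h1.congr_deriv ?_
    have : 0 < √(p ^ 2 + 4 * j * √(v y)) := Real.sqrt_pos.2 hin
    unfold speed
    field_simp
    ring
  refine h2.congr_of_eventuallyEq ?_
  filter_upwards [Ioo_mem_nhds hy.1 hy.2] with z hz
  exact (hd z hz).deriv

theorem isFreeBoundarySolution_of_isVariationalSolution {j : ℝ} (hj : 4 / 9 ≤ j) {v : ℝ → ℝ}
    (hv : IsVariationalSolution j v) : IsFreeBoundarySolution j v (freeBoundary j) := by
  have hj0 : 0 < j := by linarith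
  have hsol := isSpeedSolution_freeSolution hj
  have hEq : EqOn v (freeSolution j) (Icc 0 1) := hsol.eqOn_of_isVariationalSolution hj0.le hv
  have hd := fun y hy => hsol.hasDerivWithinAt_of_isVariationalSolution hj0.le hv (y := y) hy
  have hξ0 := freeBoundary_nonneg hj
  have hξ1 := freeBoundary_lt_one hj0
  have hξ : freeBoundary j ∈ Icc (0 : ℝ) 1 := ⟨hξ0, hξ1.le⟩
  have hpos : ∀ y ∈ Ioc (freeBoundary j) 1, 0 < v y := fun y hy => by
    rw [hEq ⟨hξ0.trans hy.1.le, hy.2⟩]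
    exact freeSolution_pos hj0 hy.1
  have hzero : ∀ y ∈ Icc 0 (freeBoundary j), v y = 0 := fun y hy => by
    rw [hEq ⟨hy.1, hy.2.trans hξ1.le⟩]
    exact freeSolution_eq_zero hy.2
  refine ⟨hv.1, (contDiffOn_of_hasDerivWithinAt_speed hd).mono Ico_subset_Icc_self,
    ⟨⟨hξ0, hξ1⟩, hzero, hpos, ?_⟩, ?_, .of_hasDerivAt (fun y hy => ?_) ?_⟩
  · have := hd _ hξ
    rwa [hzero _ (right_mem_Icc.2 hξ0), speed_zero le_rfl] at this
  · refine (integrableOn_one_div_sqrt_freeSolution hj0).congr_fun (fun y hy => ?_) measurableSet_Ioo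
    simp only
    rw [hEq ⟨hξ0.trans hy.1.le, hy.2.le⟩]
  · exact hasDerivAt_deriv_of_hasDerivWithinAt_speed hj0 hd ⟨hξ0.trans_lt hy.1, hy.2⟩
      (hpos y ⟨hy.1, hy.2.le⟩)
  · exact continuousOn_const.div
      (hv.1.2.1.mono fun y hy => ⟨hξ0.trans hy.1.le, hy.2.le⟩).sqrt
      fun y hy => (Real.sqrt_pos.2 (hpos y ⟨hy.1, hy.2.le⟩)).ne'

theorem exists_isSpeedSolution_of_pos {j : ℝ} (hj : 0 < j) : ∃ p u, IsSpeedSolution p j u := by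
  rcases le_or_gt (4 / 9) j with h | h
  · exact ⟨0, _, isSpeedSolution_freeSolution h⟩
  · obtain ⟨p, hp, hpj⟩ := exists_initial_slope hj h
    exact ⟨p, exists_isSpeedSolution hj hp hpj⟩

theorem IsSpeedSolution.pos_of_isVariationalSolution {p j : ℝ} (hp : 0 < p) (hj : 0 ≤ j)
    {u v : ℝ → ℝ} (hu : IsSpeedSolution p j u) (hv : IsVariationalSolution j v) {y : ℝ}
    (hy : y ∈ Ioc (0 : ℝ) 1) : 0 < v y := by
  rw [hu.eq_integral_of_isVariationalSolution hj hv (Ioc_subset_Icc_self hy)]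
  have hc : ContinuousOn (fun y => speed p j (v y)) (Icc 0 y) :=
    (continuous_speed p j).comp_continuousOn (hv.1.2.1.mono (Icc_subset_Icc_right hy.2))
  refine intervalIntegral.intervalIntegral_pos_of_pos_on
    (hc.intervalIntegrable_of_Icc hy.1.le) (fun t _ => ?_) hy.1
  exact Real.sqrt_pos.2 (by positivity)

end ChildLangmuir

theorem theorem10 (j : ℝ) (hj : 0 < j) :
    (∃ u : ℝ → ℝ, ChildLangmuir.IsVariationalSolution j u ∧
      ∀ v : ℝ → ℝ, ChildLangmuir.IsVariationalSolution j v → Set.EqOn v u (Set.Icc 0 1)) ∧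
    ∀ u : ℝ → ℝ, ChildLangmuir.IsVariationalSolution j u →
      (j = ChildLangmuir.jStar →
        ChildLangmuir.IsFlatSolution j u ∧
          ∀ y ∈ Set.Icc (0 : ℝ) 1, u y = y ^ (4 / 3 : ℝ)) ∧
      (ChildLangmuir.jStar < j →
        ChildLangmuir.IsFreeBoundarySolution j u (1 - 1 / √(9 / 4 * j)) ∧
          ∀ y ∈ Set.Icc (0 : ℝ) 1,
            u y = (9 / 4 * j) ^ (2 / 3 : ℝ) *
              (max (y - (1 - 1 / √(9 / 4 * j))) 0) ^ (4 / 3 : ℝ)) ∧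
      (j < ChildLangmuir.jStar →
        (∀ y ∈ Set.Ioc (0 : ℝ) 1, 0 < u y) ∧
          ∃ K₀ : ℝ, 0 < K₀ ∧ HasDerivWithinAt u K₀ (Set.Icc 0 1) 0) := by
  open ChildLangmuir in
  refine ⟨?_, fun u hu => ⟨fun h => ?_, fun h => ?_, fun h => ?_⟩⟩
  · obtain ⟨p, u, hu⟩ := exists_isSpeedSolution_of_pos hj
    exact ⟨u, hu.isVariationalSolution hj.le, fun v hv =>
      hu.eqOn_of_isVariationalSolution hj.le hv⟩
  · have h49 : j = 4 / 9 := h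
    have hξ : freeBoundary j = 0 := by rw [freeBoundary, h49]; norm_num
    have hfree := isFreeBoundarySolution_of_isVariationalSolution h49.ge hu
    rw [hξ] at hfree
    refine ⟨hfree, fun y hy => ?_⟩
    rw [(isSpeedSolution_freeSolution h49.ge).eqOn_of_isVariationalSolution hj.le hu hy,
      freeSolution, hξ, sub_zero, max_eq_left hy.1, h49]
    norm_num
  · have h49 : 4 / 9 ≤ j := le_of_lt h
    exact ⟨isFreeBoundarySolution_of_isVariationalSolution h49 hu, fun y hy =>
      (isSpeedSolution_freeSolution h49).eqOn_of_isVariationalSolution hj.le hu hy⟩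
  · obtain ⟨p, hp, hpj⟩ := exists_initial_slope hj h
    obtain ⟨w, hw⟩ := exists_isSpeedSolution hj hp hpj
    refine ⟨fun y hy => hw.pos_of_isVariationalSolution hp hj.le hu hy, p, hp, ?_⟩
    have hd := hw.hasDerivWithinAt_of_isVariationalSolution hj.le hu (left_mem_Icc.2 zero_le_one)
    rwa [hu.1.2.2.1, speed_zero hp.le] at hd
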